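/- Let $p$ be an odd prime, let $r\ge 1$, let $\mathbb K$ be a field of order $p^r$ and let $G=\operatorname{SL}_2(\mathbb K)=\operatorname{SL}_2(p^r)$. Let $V_{p-1}(p^r)$ be the space of homogeneous polynomials of degree $p-1$ in $\mathbb K[x,y]$, on which $G$ acts on the right by the substitutions $x\cdot g=ax+by$, $y\cdot g=cx+dy$ for $g=\left(\begin{smallmatrix}a&b\\c&d\end{smallmatrix}\right)$, regarded as an $\mathbb F_pG$-module (of dimension $pr$ over $\mathbb F_p$). An $\mathbb F_pG$-module $V$ of dimension $n$, afforded by $\theta:G\to\operatorname{GL}_n(\mathbb F_p)$ with respect to some basis, *lifts to* $\mathbb Z/p^s\mathbb Z$ if there is a homomorphism $\widehat\theta:G\to\operatorname{GL}_n(\mathbb Z/p^s\mathbb Z)$ whose entrywise reduction modulo $p$ is $\theta$. It *lifts to* $\mathbb Q_p$ if there are a finite-dimensional $\mathbb Q_pG$-module $E$ and a $G$-stable $\mathbb Z_p$-lattice $L\subset E$ such that $L/pL\cong V$ as $\mathbb F_pG$-modules. Then $V_{p-1}(p^r)$ lifts to $\mathbb Z/p^2\mathbb Z$ if and only if $r=1$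 (in particular, $V_2(9)$ does not lift to $\mathbb Z/9\mathbb Z$). Moreover, the Steinberg module $V_{p-1}(p)$ lifts to $\mathbb Q_p$. -/

import Mathlib

open MvPolynomial Matrix

/-- The substitution `x ↦ a x + b y`, `y ↦ c x + d y` on `K[x, y]` attached to a `2 × 2` matrix
`!![a, b; c, d]`; here `x = X 0` and `y = X 1`. -/
noncomputable def polySubst {K : Type*} [CommRing K] (g : Matrix (Fin 2) (Fin 2) K) :
    MvPolynomial (Fin 2) K →ₐ[K] MvPolynomial (Fin 2) K :=
  aeval (fun i => C (g i 0) * X 0 + C (g i 1) * X 1)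

theorem polySubst_one {K : Type*} [CommRing K] :
    polySubst (1 : Matrix (Fin 2) (Fin 2) K) = AlgHom.id K _ := by
  apply MvPolynomial.algHom_ext
  intro i
  fin_cases i <;> simp [polySubst]

theorem polySubst_mul {K : Type*} [CommRing K] (g h : Matrix (Fin 2) (Fin 2) K) :
    polySubst (g * h) = (polySubst h).comp (polySubst g) := by
  apply MvPolynomial.algHom_ext
  intro i
  simp [polySubst, Matrix.mul_apply, Fin.sum_univ_two, algHom_C]
  ring

theorem polySubst_mem {K : Type*} [CommRing K] (g : Matrix (Fin 2) (Fin 2) K) (n : ℕ)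
    {f : MvPolynomial (Fin 2) K} (hf : f ∈ homogeneousSubmodule (Fin 2) K n) :
    polySubst g f ∈ homogeneousSubmodule (Fin 2) K n := by
  have hg : ∀ i : Fin 2,
      (C (g i 0) * X 0 + C (g i 1) * X 1 : MvPolynomial (Fin 2) K).IsHomogeneous 1 := by
    intro i
    refine IsHomogeneous.add ?_ ?_
    · simpa using (isHomogeneous_C (Fin 2) (g i 0)).mul (isHomogeneous_X K (0 : Fin 2))
    · simpa using (isHomogeneous_C (Fin 2) (g i 1)).mul (isHomogeneous_X K (1 : Fin 2))
  have h := IsHomogeneous.aeval ((mem_homogeneousSubmodule n f).1 hf) _ hg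
  rw [one_mul] at h
  exact (mem_homogeneousSubmodule n _).2 h

/-- The module `V_n` of `SL₂(K)`: homogeneous polynomials of degree `n` in `K[x, y]`, regarded as
a representation over a base ring `k` of `K` (below, the prime field). The right action
`x · g = a x + b y`, `y · g = c x + d y` is written as a left action through
`g • f = f · g⁻¹`. -/
noncomputable def homPolyRep (k K : Type*) [CommRing k] [CommRing K] [Algebra k K] (n : ℕ) :
    Representation k (Matrix.SpecialLinearGroup (Fin 2) K) (homogeneousSubmodule (Fin 2) K n) where
  toFun g := ((polySubst (g⁻¹ : Matrix.SpecialLinearGroup (Fin 2) K)).toLinearMap.restrict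
    (fun _ hf => polySubst_mem _ n hf)).restrictScalars k
  map_one' := by
    ext f : 2
    simp [polySubst_one]
  map_mul' g h := by
    ext f : 2
    have e : (((g * h)⁻¹ : Matrix.SpecialLinearGroup (Fin 2) K) : Matrix (Fin 2) (Fin 2) K)
        = (h⁻¹ : Matrix.SpecialLinearGroup (Fin 2) K) * (g⁻¹ : Matrix.SpecialLinearGroup (Fin 2) K) := by
      rw [_root_.mul_inv_rev, Matrix.SpecialLinearGroup.coe_mul]
    change polySubst ((g * h)⁻¹ : Matrix.SpecialLinearGroup (Fin 2) K) f.1 =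
      polySubst (g⁻¹ : Matrix.SpecialLinearGroup (Fin 2) K)
        (polySubst (h⁻¹ : Matrix.SpecialLinearGroup (Fin 2) K) f.1)
    rw [e, polySubst_mul, AlgHom.comp_apply]

/-- A finite-dimensional representation of `G` over `ZMod p` lifts to `ZMod (p ^ s)` if, for some
basis, the corresponding homomorphism `G → GL_n(ZMod p)` is the entrywise reduction of a
homomorphism `G → GL_n(ZMod (p ^ s))`. -/
def LiftsToZModPow {p : ℕ} {G V : Type*} [Group G] [AddCommGroup V] [Module (ZMod p) V]
    (ρ : Representation (ZMod p) G V) (s : ℕ) (hs : s ≠ 0) : Prop :=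
  ∃ (n : ℕ) (b : Module.Basis (Fin n) (ZMod p) V) (θ : G →* GL (Fin n) (ZMod (p ^ s))),
    ∀ g : G, (θ g).1.map (ZMod.castHom (dvd_pow_self p hs) (ZMod p)) =
      LinearMap.toMatrix b b (ρ g)

/-- A representation `ρ` of `G` over `ZMod p` lifts to `ℚ_[p]` if there is a finite-dimensional
representation `σ` of `G` over `ℚ_[p]` and a `G`-stable `ℤ_[p]`-lattice `L` in it with `L / p L`
isomorphic to `ρ`. An additive `G`-equivariant isomorphism is automatically linear over the
prime field. -/
def LiftsToPadic {p : ℕ} [Fact p.Prime] {G V : Type*} [Group G] [AddCommGroup V]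
    [Module (ZMod p) V] (ρ : Representation (ZMod p) G V) : Prop :=
  ∃ (n : ℕ) (σ : Representation ℚ_[p] G (Fin n → ℚ_[p]))
    (L : Submodule ℤ_[p] (Fin n → ℚ_[p])) (_ : Submodule.IsLattice ℚ_[p] L)
    (hL : ∀ (g : G) (v : L), σ g v.1 ∈ L)
    (e : (L ⧸ (Ideal.span {(p : ℤ_[p])} • ⊤ : Submodule ℤ_[p] L)) ≃+ V),
    ∀ (g : G) (v : L),
      e (Submodule.Quotient.mk ⟨σ g v.1, hL g v⟩) = ρ g (e (Submodule.Quotient.mk v))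

/-! Suppose first that there is a lift `M` to `ZMod (p ^ 2)`, with reduction `V`. Since `M` is free,
the kernel of `M → V` is `pM`, which is also the `p`-torsion of `M`. Because `p` is odd, two
commuting elements of exponent `p` with the same fixed vectors on `V` must then have the same norm
`1 + g + ... + g ^ (p - 1)` on `V` (`map_norm_eq_map_norm`). The shifts `x ↦ x + a y` with `a ≠ 0`
commute and all fix exactly the multiples of `y ^ (p - 1)`. The norm of such a shift sends `x ^ (p -
1)` to a form whose value at `(0, 1)` is `-a ^ (p - 1)`. Hence `a ^ (p - 1) = 1` for every nonzero
`a`, which forces `K` to have order `p`.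

Conversely, over a field of order `q`, forms of degree `q - 1` have well-defined values on the
projective line, because `(q - 1)`-st powers of nonzero scalars are `1`. Evaluation identifies them
with the functions of sum zero there (`formEquiv_homPolyRep`). That permutation module is defined
over the integers, so for `q = p` it supplies both lifts. -/

/-! ### Evaluation of binary forms -/

theorem homPolyRep_apply_coe (k K : Type*) [CommRing k] [CommRing K] [Algebra k K] (n : ℕ)
    (g : Matrix.SpecialLinearGroup (Fin 2) K) (f : homogeneousSubmodule (Fin 2) K n) :
    (homPolyRep k K n g f : MvPolynomial (Fin 2) K) =
      polySubst (g⁻¹ : Matrix.SpecialLinearGroup (Fin 2) K) f := rfl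

theorem eval_polySubst {K : Type*} [CommRing K] (g : Matrix (Fin 2) (Fin 2) K) (v : Fin 2 → K)
    (f : MvPolynomial (Fin 2) K) : eval v (polySubst g f) = eval (g *ᵥ v) f := by
  have : (aeval v).comp (polySubst g) = aeval (R := K) (g *ᵥ v) := by
    apply MvPolynomial.algHom_ext
    intro i
    fin_cases i <;> simp [polySubst]
  simpa [MvPolynomial.aeval_eq_eval] using DFunLike.congr_fun this f

theorem eval_smul_of_isHomogeneous {K σ : Type*} [CommRing K] {n : ℕ}
    {f : MvPolynomial σ K} (hf : f.IsHomogeneous n) (c : K) (v : σ → K) :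
    eval (c • v) f = c ^ n * eval v f := by
  rw [eval_eq, eval_eq, Finset.mul_sum]
  refine Finset.sum_congr rfl fun d hd => ?_
  have h := hf (mem_support_iff.1 hd)
  simp only [Pi.smul_apply, smul_eq_mul, mul_pow, Finset.prod_mul_distrib,
    Finset.prod_pow_eq_pow_sum]
  rw [show ∑ i ∈ d.support, d i = n by simpa [Finsupp.weight_apply, Finsupp.sum] using h]
  ring

/-- A binary form of degree `n` that vanishes at more than `n` points `(t, 1)` is zero. -/
theorem eq_zero_of_eval_eq_zero_of_lt_card {K : Type*} [CommRing K] [IsDomain K] {n : ℕ}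
    {f : MvPolynomial (Fin 2) K} (hf : f.IsHomogeneous n) (S : Finset K) (hS : n < S.card)
    (h : ∀ t ∈ S, eval ![t, 1] f = 0) : f = 0 := by
  -- Dehomogenise at `y = 1`. Nothing is lost: in degree `n` the exponent of `x` determines that of
  -- `y`.
  set q : Polynomial K := aeval ![Polynomial.X, 1] f with hq
  have hqs : q = ∑ d ∈ f.support, Polynomial.monomial (d 0) (coeff d f) := by
    rw [hq, aeval_def, eval₂_eq']
    refine Finset.sum_congr rfl fun d _ => ?_
    simp [Fin.prod_univ_two, Polynomial.C_mul_X_pow_eq_monomial]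
  have hdeg : ∀ d ∈ f.support, d 0 + d 1 = n := fun d hd => by
    simpa [Finsupp.weight_apply, Finsupp.sum_fintype, Fin.sum_univ_two]
      using hf (mem_support_iff.1 hd)
  have hq0 : q = 0 := by
    refine Polynomial.eq_zero_of_natDegree_lt_card_of_eval_eq_zero' q S (fun t ht => ?_)
      (lt_of_le_of_lt ?_ hS)
    · have : (Polynomial.aeval t).comp (aeval ![Polynomial.X, 1]) =
          aeval (R := K) (![t, 1] : Fin 2 → K) := by
        apply MvPolynomial.algHom_ext
        intro i
        fin_cases i <;> simp
      have h2 := DFunLike.congr_fun this f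
      rw [AlgHom.comp_apply, MvPolynomial.aeval_eq_eval] at h2
      rw [← h t ht]
      simpa using h2
    · rw [hqs]
      refine Polynomial.natDegree_sum_le_of_forall_le _ _ fun d hd => ?_
      refine (Polynomial.natDegree_monomial_le _).trans ?_
      have := hdeg d hd
      omega
  ext d
  by_contra hd
  have hd' : d ∈ f.support := mem_support_iff.2 hd
  apply hd
  have hc : q.coeff (d 0) = 0 := by simp [hq0]
  rw [hqs, Polynomial.finsetSum_coeff, Finset.sum_eq_single d] at hc
  · simpa using hc
  · intro e he hne
    rw [Polynomial.coeff_monomial, if_neg]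
    intro h0
    apply hne
    have h1 := hdeg e he
    have h2 := hdeg d hd'
    ext i
    fin_cases i
    · exact h0
    · simp only [Fin.mk_one]; omega
  · exact fun h => absurd hd' h

theorem eq_of_eval_eq_of_lt_card {K : Type*} [CommRing K] [IsDomain K] {n : ℕ}
    {f g : MvPolynomial (Fin 2) K} (hf : f.IsHomogeneous n) (hg : g.IsHomogeneous n)
    (S : Finset K) (hS : n < S.card) (h : ∀ t ∈ S, eval ![t, 1] f = eval ![t, 1] g) : f = g :=
  sub_eq_zero.1 <| eq_zero_of_eval_eq_zero_of_lt_card (hf.sub hg) S hS fun t ht => by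
    rw [map_sub, h t ht, sub_self]

/-! ### Unipotent elements and their fixed forms -/

/-- The unipotent element of `SL₂` acting on forms by `x ↦ x + a y`, `y ↦ y`. -/
def shiftElement {K : Type*} [CommRing K] (a : K) : Matrix.SpecialLinearGroup (Fin 2) K :=
  ⟨!![1, -a; 0, 1], by simp [Matrix.det_fin_two]⟩

theorem coe_shiftElement {K : Type*} [CommRing K] (a : K) :
    (shiftElement a : Matrix (Fin 2) (Fin 2) K) = !![1, -a; 0, 1] := rfl

theorem coe_shiftElement_inv {K : Type*} [CommRing K] (a : K) :
    (((shiftElement a)⁻¹ : Matrix.SpecialLinearGroup (Fin 2) K) : Matrix (Fin 2) (Fin 2) K) =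
      !![1, a; 0, 1] := by
  rw [Matrix.SpecialLinearGroup.coe_inv, coe_shiftElement, Matrix.adjugate_fin_two_of, neg_neg,
    neg_zero]

theorem shiftElement_mul {K : Type*} [CommRing K] (a b : K) :
    shiftElement a * shiftElement b = shiftElement (a + b) := by
  ext i j
  fin_cases i <;> fin_cases j <;> simp [coe_shiftElement, Matrix.mul_apply, Fin.sum_univ_two,
    add_comm]

theorem shiftElement_pow {K : Type*} [CommRing K] (a : K) (n : ℕ) :
    shiftElement a ^ n = shiftElement (n * a) := by
  induction n with
  | zero =>
    ext i j
    fin_cases i <;> fin_cases j <;> simp [coe_shiftElement]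
  | succ n ih => rw [pow_succ, ih, shiftElement_mul]; push_cast; ring_nf

theorem eval_homPolyRep_shiftElement (k : Type*) {K : Type*} [CommRing k] [CommRing K]
    [Algebra k K] (n : ℕ) (a s t : K) (f : homogeneousSubmodule (Fin 2) K n) :
    eval ![s, t] (homPolyRep k K n (shiftElement a) f : MvPolynomial (Fin 2) K) =
      eval ![s + a * t, t] (f : MvPolynomial (Fin 2) K) := by
  rw [homPolyRep_apply_coe, eval_polySubst, coe_shiftElement_inv]
  congr 2
  ext i
  fin_cases i <;> simp [mul_comm]

open Classical in
/-- In characteristic `p`, a form of degree `p - 1` fixed by one nontrivial shift is a multiple of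
`y ^ (p - 1)`, and hence fixed by all of them. -/
theorem homPolyRep_shiftElement_eq_self (p : ℕ) [Fact p.Prime] {K : Type*} [Field K]
    [Algebra (ZMod p) K] {a : K} (ha : a ≠ 0) (b : K)
    (f : homogeneousSubmodule (Fin 2) K (p - 1))
    (h : homPolyRep (ZMod p) K (p - 1) (shiftElement a) f = f) :
    homPolyRep (ZMod p) K (p - 1) (shiftElement b) f = f := by
  have hp : 0 < p := (Fact.out : p.Prime).pos
  have : CharP K p := charP_of_injective_algebraMap (algebraMap (ZMod p) K).injective p
  have hstep : ∀ t : K, eval ![t + a, 1] (f : MvPolynomial (Fin 2) K) =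
      eval ![t, 1] (f : MvPolynomial (Fin 2) K) := fun t => by
    conv_rhs => rw [← h]
    rw [eval_homPolyRep_shiftElement, mul_one]
  have hmul : ∀ i : ℕ, eval ![i * a, 1] (f : MvPolynomial (Fin 2) K) =
      eval ![0, 1] (f : MvPolynomial (Fin 2) K) := fun i => by
    induction i with
    | zero => simp
    | succ i ih => rw [← ih, ← hstep (i * a)]; push_cast; ring_nf
  set c := eval ![0, 1] (f : MvPolynomial (Fin 2) K)
  have hy : (C c * X 1 ^ (p - 1) : MvPolynomial (Fin 2) K).IsHomogeneous (p - 1) := by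
    simpa using (isHomogeneous_C (Fin 2) c).mul ((isHomogeneous_X K (1 : Fin 2)).pow (p - 1))
  -- Both sides agree at the `p` distinct points `(i * a, 1)`, one more than the degree.
  have hf : (f : MvPolynomial (Fin 2) K) = C c * X 1 ^ (p - 1) := by
    have hinj : Set.InjOn (fun i : ℕ => (i : K) * a) (Finset.range p) := by
      intro i hi j hj hij
      have hij' : (i : K) = j := mul_right_cancel₀ ha hij
      rw [CharP.natCast_eq_natCast K p] at hij'
      simp only [Finset.coe_range, Set.mem_Iio] at hi hj
      exact Nat.ModEq.eq_of_lt_of_lt hij' hi hj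
    refine eq_of_eval_eq_of_lt_card f.2 hy
      ((Finset.range p).image fun i : ℕ => (i : K) * a) ?_ ?_
    · rw [Finset.card_image_of_injOn hinj, Finset.card_range]
      omega
    · intro t ht
      obtain ⟨i, -, rfl⟩ := Finset.mem_image.1 ht
      simp [hmul i]
  apply Subtype.ext
  rw [homPolyRep_apply_coe, hf, coe_shiftElement_inv]
  simp [polySubst]

/-! ### Norms of automorphisms of exponent `p` -/

section Norm

variable {R M V : Type*} [CommRing R] [AddCommGroup M] [Module R M] [AddCommGroup V]

/-- If `M` reduces to `V` modulo `p` and `π m = 0` characterises the `p`-torsion, then on the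
image of the norm of `A` an automorphism `B` with the same fixed points on `V` has norm `p`. -/
theorem norm_comp_norm_eq_nsmul {p : ℕ} (hp : p.Prime) (hp2 : p ≠ 2) (A B : Module.End R M)
    (a b : V → V) (π : M →+ V) (hker : ∀ m, π m = 0 → ∃ m', m = p • m')
    (htors : ∀ m, p • m = 0 ↔ π m = 0)
    (hA : ∀ m, π (A m) = a (π m)) (hB : ∀ m, π (B m) = b (π m)) (hA1 : A ^ p = 1)
    (hAB : Commute A B) (hab : ∀ v, a v = v → b v = v) (m : M) :
    (∑ i ∈ Finset.range p, B ^ i) ((∑ i ∈ Finset.range p, A ^ i) m) =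
      p • (∑ i ∈ Finset.range p, A ^ i) m := by
  set w := (∑ i ∈ Finset.range p, A ^ i) m with hw
  have hAw : A w = w := by
    have h := mul_geom_sum A p
    rw [hA1, sub_self] at h
    have h2 := DFunLike.congr_fun h m
    rw [Module.End.mul_apply, ← hw] at h2
    simpa [sub_eq_zero] using h2
  have hBw : π (B w - w) = 0 := by
    rw [map_sub, hB, hab, sub_self]
    rw [← hA, hAw]
  obtain ⟨m', hm'⟩ := hker _ hBw
  have hpp : p • p • m' = 0 := by rw [← hm']; exact (htors _).2 hBw
  have hAm' : A (p • m') = p • m' := by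
    rw [← hm', map_sub, hAw, ← Module.End.mul_apply, hAB.eq, Module.End.mul_apply, hAw]
  -- Multiplication by `p` identifies `M` modulo `ker π` with `pM`, so fixing `p • m'` amounts to
  -- fixing `π m'`.
  have hfix : a (π m') = π m' := by
    have h : π (A m' - m') = 0 := by
      rw [← htors, smul_sub, ← map_nsmul, hAm', sub_self]
    rw [map_sub, hA, sub_eq_zero] at h
    exact h
  have hBm' : B (p • m') = p • m' := by
    have h : p • (B m' - m') = 0 := by
      rw [htors, map_sub, hB, hab _ hfix, sub_self]
    rw [smul_sub, sub_eq_zero] at h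
    rw [map_nsmul, h]
  have hBi : ∀ i : ℕ, (B ^ i) w = w + i • p • m' := fun i => by
    induction i with
    | zero => simp
    | succ i ih =>
      rw [pow_succ', Module.End.mul_apply, ih, map_add, map_nsmul, hBm',
        eq_add_of_sub_eq hm', succ_nsmul]
      abel
  -- This is where `p ≠ 2` enters: `p (p - 1) / 2` is a multiple of `p`, so the error terms `i • p •
  -- m'` sum to zero.
  obtain ⟨k, hk⟩ : p ∣ ∑ i ∈ Finset.range p, i := by
    obtain ⟨j, hj⟩ := hp.odd_of_ne_two hp2
    rw [Finset.sum_range_id, hj, Nat.add_sub_cancel, mul_left_comm, Nat.mul_div_cancel_left _ two_pos]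
    exact dvd_mul_right _ _
  rw [LinearMap.sum_apply, Finset.sum_congr rfl fun i _ => hBi i, Finset.sum_add_distrib,
    ← Finset.sum_smul, hk, mul_comm, mul_smul, hpp, smul_zero, add_zero]
  simp

/-- The norms commute, so their product on `m` is `p` times either norm. Their difference is thus
`p`-torsion, which `π` kills. -/
theorem map_norm_eq_map_norm {p : ℕ} (hp : p.Prime) (hp2 : p ≠ 2) (A B : Module.End R M)
    (a b : V → V) (π : M →+ V) (hker : ∀ m, π m = 0 → ∃ m', m = p • m')
    (htors : ∀ m, p • m = 0 ↔ π m = 0)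
    (hA : ∀ m, π (A m) = a (π m)) (hB : ∀ m, π (B m) = b (π m)) (hA1 : A ^ p = 1) (hB1 : B ^ p = 1)
    (hAB : Commute A B) (hab : ∀ v, a v = v ↔ b v = v) (m : M) :
    π ((∑ i ∈ Finset.range p, A ^ i) m) = π ((∑ i ∈ Finset.range p, B ^ i) m) := by
  have h1 := norm_comp_norm_eq_nsmul hp hp2 A B a b π hker htors hA hB hA1 hAB
    (fun v => (hab v).1) m
  have h2 := norm_comp_norm_eq_nsmul hp hp2 B A b a π hker htors hB hA hB1 hAB.symm
    (fun v => (hab v).2) m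
  have hc : Commute (∑ i ∈ Finset.range p, A ^ i) (∑ i ∈ Finset.range p, B ^ i) :=
    Commute.sum_left _ _ _ fun i _ => Commute.sum_right _ _ _ fun j _ => hAB.pow_pow i j
  rw [← Module.End.mul_apply, hc.eq, Module.End.mul_apply, h1] at h2
  rw [← sub_eq_zero, ← map_sub, ← htors, smul_sub, h2, sub_self]

end Norm

/-! ### Lifts to `ZMod (p ^ 2)` force `r = 1` -/

theorem ZMod.castHom_sq_eq_zero_iff {p : ℕ} (hp : p ≠ 0) (x : ZMod (p ^ 2)) :
    ZMod.castHom (dvd_pow_self p two_ne_zero) (ZMod p) x = 0 ↔ (p : ZMod (p ^ 2)) * x = 0 := by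
  have : NeZero (p ^ 2) := ⟨pow_ne_zero 2 hp⟩
  obtain ⟨v, rfl⟩ := ZMod.natCast_zmod_surjective x
  rw [map_natCast, ← Nat.cast_mul, ZMod.natCast_eq_zero_iff, ZMod.natCast_eq_zero_iff, sq,
    Nat.mul_dvd_mul_iff_left (Nat.pos_of_ne_zero hp)]

theorem ZMod.exists_eq_mul_of_castHom_sq_eq_zero {p : ℕ} (hp : p ≠ 0) (x : ZMod (p ^ 2))
    (h : ZMod.castHom (dvd_pow_self p two_ne_zero) (ZMod p) x = 0) :
    ∃ y : ZMod (p ^ 2), x = (p : ZMod (p ^ 2)) * y := by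
  have : NeZero (p ^ 2) := ⟨pow_ne_zero 2 hp⟩
  obtain ⟨v, rfl⟩ := ZMod.natCast_zmod_surjective x
  rw [map_natCast, ZMod.natCast_eq_zero_iff] at h
  obtain ⟨w, rfl⟩ := h
  exact ⟨w, by push_cast; rfl⟩

/-- If a representation over `ZMod p` lifts to `ZMod (p ^ 2)`, then two commuting elements of
exponent `p` with the same fixed vectors have the same norm. -/
theorem LiftsToZModPow.sum_pow_eq_sum_pow {p : ℕ} (hp : p.Prime) (hp2 : p ≠ 2) {G V : Type*}
    [Group G] [AddCommGroup V] [Module (ZMod p) V] {ρ : Representation (ZMod p) G V}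
    (hρ : LiftsToZModPow ρ 2 two_ne_zero) {g h : G} (hg : g ^ p = 1) (hh : h ^ p = 1)
    (hgh : Commute g h) (hfix : ∀ v, ρ g v = v ↔ ρ h v = v) (v : V) :
    ∑ i ∈ Finset.range p, ρ (g ^ i) v = ∑ i ∈ Finset.range p, ρ (h ^ i) v := by
  obtain ⟨n, b, θ, hθ⟩ := hρ
  set φ := ZMod.castHom (dvd_pow_self p two_ne_zero) (ZMod p)
  let π : (Fin n → ZMod (p ^ 2)) →+ V :=
    b.equivFun.symm.toLinearMap.toAddMonoidHom.comp (φ.toAddMonoidHom.compLeft (Fin n))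
  have hπ : ∀ m, π m = b.equivFun.symm (fun i => φ (m i)) := fun _ => rfl
  have hπ0 : ∀ m, π m = 0 ↔ ∀ i, φ (m i) = 0 := fun m => by
    rw [hπ, LinearEquiv.map_eq_zero_iff, funext_iff]
    rfl
  let A : G →* Module.End (ZMod (p ^ 2)) (Fin n → ZMod (p ^ 2)) :=
    (Matrix.toLinAlgEquiv' (R := ZMod (p ^ 2)) (n := Fin n)).toRingEquiv.toRingHom.toMonoidHom.comp
      ((Units.coeHom _).comp θ)
  have hA : ∀ x m, π (A x m) = ρ x (π m) := fun x m => by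
    have h1 : A x m = (θ x).1 *ᵥ m := rfl
    rw [hπ, hπ, LinearEquiv.symm_apply_eq, Module.Basis.equivFun_apply,
      ← LinearMap.toMatrix_mulVec_repr b b, ← hθ, h1]
    have h2 : ⇑(b.repr (b.equivFun.symm fun i => φ (m i))) = fun i => φ (m i) := by
      rw [← Module.Basis.equivFun_apply, LinearEquiv.apply_symm_apply]
    rw [h2]
    ext i
    exact RingHom.map_mulVec φ _ _ i
  obtain ⟨m, rfl⟩ : ∃ m, π m = v := by
    refine ⟨fun i => (ZMod.castHom_surjective (dvd_pow_self p two_ne_zero) (b.equivFun v i)).choose,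
      ?_⟩
    rw [hπ, LinearEquiv.symm_apply_eq]
    ext i
    exact (ZMod.castHom_surjective (dvd_pow_self p two_ne_zero) (b.equivFun v i)).choose_spec
  have key := map_norm_eq_map_norm hp hp2 (A g) (A h) (ρ g) (ρ h) π ?_ ?_ (hA g) (hA h)
    (by rw [← map_pow, hg, map_one]) (by rw [← map_pow, hh, map_one]) (hgh.map A) hfix m
  · simpa only [LinearMap.sum_apply, map_sum, ← map_pow, hA] using key
  · intro m hm
    rw [hπ0] at hm
    choose m' hm' using fun i => ZMod.exists_eq_mul_of_castHom_sq_eq_zero hp.ne_zero _ (hm i)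
    exact ⟨m', funext fun i => by rw [hm', Pi.smul_apply, nsmul_eq_mul]⟩
  · intro m
    rw [hπ0, funext_iff]
    refine forall_congr' fun i => ?_
    rw [ZMod.castHom_sq_eq_zero_iff hp.ne_zero, Pi.smul_apply, nsmul_eq_mul]
    rfl

theorem eq_one_of_liftsToZModPow {p : ℕ} [Fact p.Prime] (hp : p ≠ 2) {r : ℕ}
    {K : Type*} [Field K] [Algebra (ZMod p) K] (hK : Nat.card K = p ^ r)
    (h : LiftsToZModPow (homPolyRep (ZMod p) K (p - 1)) 2 two_ne_zero) : r = 1 := by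
  have hp' : p.Prime := Fact.out
  have : CharP K p := charP_of_injective_algebraMap (algebraMap (ZMod p) K).injective p
  have : Finite K := Nat.finite_of_card_ne_zero (hK ▸ pow_ne_zero r hp'.ne_zero)
  have : Fintype K := Fintype.ofFinite K
  have hpow : ∀ a : K, shiftElement a ^ p = 1 := fun a => by
    rw [shiftElement_pow, CharP.cast_eq_zero, ← pow_zero (shiftElement a), shiftElement_pow,
      Nat.cast_zero, zero_mul]
  let f : homogeneousSubmodule (Fin 2) K (p - 1) :=
    ⟨X 0 ^ (p - 1), by simpa using (isHomogeneous_X K (0 : Fin 2)).pow (p - 1)⟩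
  have hsum : ∀ a : K, eval ![0, 1] ((∑ i ∈ Finset.range p,
      homPolyRep (ZMod p) K (p - 1) (shiftElement a ^ i) f :
        homogeneousSubmodule (Fin 2) K (p - 1)) : MvPolynomial (Fin 2) K) =
      (∑ i ∈ Finset.range p, (i : K) ^ (p - 1)) * a ^ (p - 1) := fun a => by
    rw [AddSubmonoidClass.coe_finsetSum, map_sum, Finset.sum_mul]
    refine Finset.sum_congr rfl fun i _ => ?_
    rw [shiftElement_pow, eval_homPolyRep_shiftElement]
    simp [f, mul_pow]
  -- The term `i = 0` vanishes and the others are `1`, so the sum is `p - 1 = -1` in `K`.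
  have hc : (∑ i ∈ Finset.range p, (i : K) ^ (p - 1)) ≠ 0 := by
    have h1 : ∀ i ∈ Finset.range p, i ≠ 0 → (i : K) ^ (p - 1) = 1 := fun i hi hi0 => by
      have hi' : (i : ZMod p) ≠ 0 := by
        rw [Ne, ZMod.natCast_eq_zero_iff]
        exact Nat.not_dvd_of_pos_of_lt (Nat.pos_of_ne_zero hi0) (Finset.mem_range.1 hi)
      have := congrArg (algebraMap (ZMod p) K) (ZMod.pow_card_sub_one_eq_one hi')
      simpa using this
    rw [← Finset.add_sum_erase _ _ (Finset.mem_range.2 hp'.pos),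
      Finset.sum_congr rfl fun i hi =>
        h1 i (Finset.mem_of_mem_erase hi) (Finset.ne_of_mem_erase hi)]
    simp [hp'.pos, Nat.cast_sub hp'.one_le, Nat.sub_ne_zero_of_lt hp'.one_lt]
  have hone : ∀ x : Kˣ, x ^ (p - 1) = 1 := fun x => by
    have h1 := h.sum_pow_eq_sum_pow hp' hp (hpow (x : K)) (hpow 1)
      (by rw [Commute, SemiconjBy, shiftElement_mul, shiftElement_mul, add_comm])
      (fun v => ⟨homPolyRep_shiftElement_eq_self p x.ne_zero _ v,
        homPolyRep_shiftElement_eq_self p one_ne_zero _ v⟩) f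
    have h2 := congrArg (fun v : homogeneousSubmodule (Fin 2) K (p - 1) =>
      eval ![0, 1] (v : MvPolynomial (Fin 2) K)) h1
    simp only [hsum] at h2
    have h3 := mul_left_cancel₀ hc h2
    rw [one_pow] at h3
    exact Units.ext (by simpa using h3)
  -- The unit group is cyclic of order `p ^ r - 1`, which therefore divides `p - 1`.
  rw [FiniteField.forall_pow_eq_one_iff, ← Nat.card_eq_fintype_card, hK] at hone
  have hle := Nat.le_of_dvd (Nat.sub_pos_of_lt hp'.one_lt) hone
  have hr0 : r ≠ 0 := by
    rintro rfl
    have := Finite.one_lt_card (α := K)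
    rw [hK, pow_zero] at this
    exact lt_irrefl 1 this
  have hr : p ^ r ≤ p ^ 1 := by
    have := hp'.one_lt
    rw [pow_one]
    omega
  have := (Nat.pow_le_pow_iff_right hp'.one_lt).1 hr
  omega

/-! ### Reduction of integral representations -/

section IntegralLift

variable {p : ℕ} {G V ι : Type*} [Group G] [AddCommGroup V] [Module (ZMod p) V] [Fintype ι]
  [DecidableEq ι] {ρ : Representation (ZMod p) G V}

/-- An integral matrix representation reducing to `ρ` may be indexed by some `Fin n`. -/
theorem exists_reindex_integral_lift (θ : G →* GL ι ℤ) (φ : V ≃ₗ[ZMod p] (ι → ZMod p))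
    (h : ∀ g v, φ (ρ g v) = (θ g).1.map (Int.cast : ℤ → ZMod p) *ᵥ φ v) :
    ∃ (n : ℕ) (θ' : G →* GL (Fin n) ℤ) (φ' : V ≃ₗ[ZMod p] (Fin n → ZMod p)),
      ∀ g v, φ' (ρ g v) = (θ' g).1.map (Int.cast : ℤ → ZMod p) *ᵥ φ' v := by
  let e := Fintype.equivFin ι
  refine ⟨Fintype.card ι, (Units.map (Matrix.reindexAlgEquiv ℤ ℤ e).toRingEquiv.toRingHom).comp θ,
    φ.trans (LinearEquiv.funCongrLeft _ _ e.symm), fun g v => ?_⟩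
  have h1 : ∀ v, (φ.trans (LinearEquiv.funCongrLeft _ _ e.symm)) v = φ v ∘ e.symm := fun _ => rfl
  rw [h1, h1, h]
  exact (Matrix.submatrix_mulVec_equiv ((θ g).1.map (Int.cast : ℤ → ZMod p)) (φ v ∘ e.symm)
    e.symm e.symm).symm ▸ by
      congr 2
      ext i
      simp

theorem liftsToZModPow_of_integral_lift (θ : G →* GL ι ℤ) (φ : V ≃ₗ[ZMod p] (ι → ZMod p))
    (h : ∀ g v, φ (ρ g v) = (θ g).1.map (Int.cast : ℤ → ZMod p) *ᵥ φ v) (s : ℕ) (hs : s ≠ 0) :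
    LiftsToZModPow ρ s hs := by
  obtain ⟨n, θ, φ, h⟩ := exists_reindex_integral_lift θ φ h
  refine ⟨n, Module.Basis.ofEquivFun φ,
    (Units.map (Int.castRingHom (ZMod (p ^ s))).mapMatrix.toMonoidHom).comp θ, fun g => ?_⟩
  ext i j
  rw [LinearMap.toMatrix_apply, Module.Basis.coe_ofEquivFun, ← Module.Basis.equivFun_apply,
    Module.Basis.equivFun_ofEquivFun, h, LinearEquiv.apply_symm_apply]
  simp

theorem liftsToPadic_of_integral_lift [Fact p.Prime] (θ : G →* GL ι ℤ)
    (φ : V ≃ₗ[ZMod p] (ι → ZMod p))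
    (h : ∀ g v, φ (ρ g v) = (θ g).1.map (Int.cast : ℤ → ZMod p) *ᵥ φ v) :
    LiftsToPadic ρ := by
  obtain ⟨n, θ, φ, h⟩ := exists_reindex_integral_lift θ φ h
  let σ : Representation ℚ_[p] G (Fin n → ℚ_[p]) :=
    (Matrix.toLinAlgEquiv' (R := ℚ_[p]) (n := Fin n)).toRingEquiv.toRingHom.toMonoidHom.comp
      ((Int.castRingHom ℚ_[p]).mapMatrix.toMonoidHom.comp ((Units.coeHom _).comp θ))
  let c : (Fin n → ℤ_[p]) →ₗ[ℤ_[p]] (Fin n → ℚ_[p]) :=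
    (Algebra.linearMap ℤ_[p] ℚ_[p]).compLeft (Fin n)
  have hc : Function.Injective c := fun v w hvw =>
    funext fun i => Subtype.ext (congrFun hvw i)
  have hσ : ∀ g w, σ g (c w) = c ((θ g).1.map (Int.cast : ℤ → ℤ_[p]) *ᵥ w) := fun g w => by
    have h1 : σ g (c w) = (θ g).1.map (Int.cast : ℤ → ℚ_[p]) *ᵥ c w := rfl
    rw [h1]
    ext i
    have h2 := RingHom.map_mulVec (algebraMap ℤ_[p] ℚ_[p])
      ((θ g).1.map (Int.cast : ℤ → ℤ_[p])) w i
    rw [Matrix.map_map] at h2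
    refine Eq.trans ?_ h2.symm
    congr 2
  -- The standard lattice, stable because the matrices are integral.
  let L : Submodule ℤ_[p] (Fin n → ℚ_[p]) := LinearMap.range c
  have hL : ∀ (g : G) (v : L), σ g v.1 ∈ L := by
    rintro g ⟨_, w, rfl⟩
    exact ⟨_, (hσ g w).symm⟩
  have hlat : Submodule.IsLattice ℚ_[p] L := by
    refine ⟨Module.Finite.iff_fg.1 inferInstance, ?_⟩
    rw [eq_top_iff, ← (Pi.basisFun ℚ_[p] (Fin n)).span_eq]
    refine Submodule.span_mono ?_
    rintro _ ⟨i, rfl⟩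
    refine ⟨Pi.single i 1, ?_⟩
    ext k
    by_cases hk : k = i
    · subst hk; simp [c]
    · simp [c, hk]
  let j : L ≃ₗ[ℤ_[p]] (Fin n → ℤ_[p]) := (LinearEquiv.ofInjective c hc).symm
  let _ : Module ℤ_[p] V := Module.compHom V (PadicInt.toZMod (p := p))
  let π : L →ₗ[ℤ_[p]] V :=
    { toFun := fun v => φ.symm fun i => PadicInt.toZMod (j v i)
      map_add' := fun v w => by
        rw [← map_add]
        congr 1
        ext i
        simp
      map_smul' := fun a v => by
        change φ.symm _ = (PadicInt.toZMod a : ZMod p) • φ.symm _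
        rw [← map_smul]
        congr 1
        ext i
        simp }
  have hπ : ∀ v, π v = φ.symm fun i => PadicInt.toZMod (j v i) := fun _ => rfl
  have hsurj : Function.Surjective π := fun v => by
    refine ⟨j.symm fun i => (ZMod.ringHom_surjective (PadicInt.toZMod (p := p)) (φ v i)).choose, ?_⟩
    rw [hπ, LinearEquiv.symm_apply_eq]
    ext i
    rw [LinearEquiv.apply_symm_apply]
    exact (ZMod.ringHom_surjective (PadicInt.toZMod (p := p)) (φ v i)).choose_spec
  have hker : (Ideal.span {(p : ℤ_[p])} • ⊤ : Submodule ℤ_[p] L) = LinearMap.ker π := by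
    ext v
    rw [Submodule.ideal_span_singleton_smul, Submodule.mem_smul_pointwise_iff_exists,
      LinearMap.mem_ker, hπ, LinearEquiv.map_eq_zero_iff, _root_.funext_iff]
    have hdvd : ∀ x : ℤ_[p], PadicInt.toZMod x = 0 ↔ ∃ y, x = (p : ℤ_[p]) * y := fun x => by
      rw [← RingHom.mem_ker, PadicInt.ker_toZMod, PadicInt.maximalIdeal_eq_span_p,
        Ideal.mem_span_singleton, dvd_def]
    constructor
    · rintro ⟨w, -, rfl⟩ i
      exact (hdvd _).2 ⟨j w i, by rw [map_smul]; rfl⟩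
    · intro hv
      choose y hy using fun i => (hdvd _).1 (hv i)
      refine ⟨j.symm y, trivial, j.injective ?_⟩
      rw [map_smul, LinearEquiv.apply_symm_apply]
      ext1 i
      exact (hy i).symm
  refine ⟨n, σ, L, hlat, hL, ((Submodule.quotEquivOfEq _ _ hker).trans
    (π.quotKerEquivOfSurjective hsurj)).toAddEquiv, fun g v => ?_⟩
  suffices hs : π ⟨σ g v.1, hL g v⟩ = ρ g (π v) from hs
  rw [hπ, hπ, LinearEquiv.symm_apply_eq, h, LinearEquiv.apply_symm_apply]
  have hj : j ⟨σ g v.1, hL g v⟩ = (θ g).1.map (Int.cast : ℤ → ℤ_[p]) *ᵥ j v := by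
    rw [← LinearEquiv.eq_symm_apply]
    apply Subtype.ext
    have hv : v.1 = c (j v) := congrArg Subtype.val (j.symm_apply_apply v).symm
    change σ g v.1 = c _
    rw [hv, hσ]
  rw [hj]
  ext i
  have h2 := RingHom.map_mulVec (PadicInt.toZMod (p := p))
    ((θ g).1.map (Int.cast : ℤ → ℤ_[p])) (j v) i
  rw [Matrix.map_map] at h2
  refine h2.trans ?_
  congr 2
  ext k
  simp

end IntegralLift

/-! ### Functions of sum zero as an integral permutation module -/

section SumZero

variable (A : Type*) {β : Type*} [CommRing A] [Fintype β]

/-- Extends a function on `β` to the function on `Option β` with sum zero. -/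
def sumZeroExtend : (β → A) →ₗ[A] (Option β → A) where
  toFun f x := x.elim (-∑ b, f b) f
  map_add' f g := by
    ext x
    cases x <;> simp [Finset.sum_add_distrib, add_comm]
  map_smul' a f := by
    ext x
    cases x <;> simp [Finset.mul_sum]

theorem sum_sumZeroExtend (f : β → A) : ∑ x, sumZeroExtend A f x = 0 := by
  simp [Fintype.sum_option, sumZeroExtend]

theorem sumZeroExtend_comp_some {F : Option β → A} (hF : ∑ x, F x = 0) :
    sumZeroExtend A (fun b => F (some b)) = F := by
  rw [Fintype.sum_option] at hF
  ext x
  cases x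
  · simpa [sumZeroExtend] using (eq_neg_of_add_eq_zero_left hF).symm
  · rfl

/-- The permutation representation of `Equiv.Perm (Option β)` on functions with sum zero, in terms
of their values on `β`. -/
def sumZeroRep : Equiv.Perm (Option β) →* Module.End A (β → A) where
  toFun σ := LinearMap.funLeft A A (fun b => σ⁻¹ (some b)) ∘ₗ sumZeroExtend A
  map_one' := rfl
  map_mul' σ τ := by
    apply LinearMap.ext
    intro f
    funext b
    change _ = sumZeroExtend A (fun b => sumZeroExtend A f (τ⁻¹ (some b))) (σ⁻¹ (some b))
    rw [sumZeroExtend_comp_some A (F := fun x => sumZeroExtend A f (τ⁻¹ x))]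
    · rfl
    · rw [Equiv.sum_comp τ⁻¹]
      exact sum_sumZeroExtend A _

theorem sumZeroRep_apply (σ : Equiv.Perm (Option β)) (f : β → A) (b : β) :
    sumZeroRep A σ f b = sumZeroExtend A f (σ⁻¹ (some b)) := rfl

variable [DecidableEq β]

/-- The matrices of `sumZeroRep` over the integers. -/
def sumZeroGL : Equiv.Perm (Option β) →* GL β ℤ :=
  ((LinearMap.toMatrixAlgEquiv' (R := ℤ) (n := β)).toRingEquiv.toRingHom.toMonoidHom.comp
    (sumZeroRep ℤ)).toHomUnits

/-- The matrix entries are `0`, `1` or `-1`, given by the same formula over every ring, so the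
representation commutes with base change from the integers. -/
theorem sumZeroGL_map_mulVec (σ : Equiv.Perm (Option β)) (f : β → A) :
    (sumZeroGL σ).1.map (Int.cast : ℤ → A) *ᵥ f = sumZeroRep A σ f := by
  have : (sumZeroGL σ).1.map (Int.cast : ℤ → A) = LinearMap.toMatrix' (sumZeroRep A σ) := by
    ext i j
    rw [LinearMap.toMatrix'_apply, sumZeroRep_apply, Matrix.map_apply]
    change ((sumZeroRep ℤ σ _ i : ℤ) : A) = _
    rw [sumZeroRep_apply]
    cases σ⁻¹ (some i) <;> simp [sumZeroExtend, Pi.single_apply]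
  rw [this, LinearMap.toMatrix'_mulVec]

end SumZero

/-! ### Forms of degree `q - 1` as functions on the projective line -/

section FiniteField

variable {K : Type*} [Field K] [Fintype K]

/-- The binary form of degree `q - 1` over a field of order `q` that is `1` at `(s, 1)` and `0` at
the other points `(t, 1)`. -/
noncomputable def lagrangeForm (s : K) : MvPolynomial (Fin 2) K :=
  X 1 ^ (Fintype.card K - 1) - (X 0 - C s * X 1) ^ (Fintype.card K - 1)

theorem isHomogeneous_lagrangeForm (s : K) :
    (lagrangeForm s).IsHomogeneous (Fintype.card K - 1) := by
  have h1 : (X 0 - C s * X 1 : MvPolynomial (Fin 2) K).IsHomogeneous 1 := by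
    refine (isHomogeneous_X K 0).sub ?_
    simpa using (isHomogeneous_C (Fin 2) s).mul (isHomogeneous_X K (1 : Fin 2))
  refine IsHomogeneous.sub ?_ ?_
  · simpa using (isHomogeneous_X K (1 : Fin 2)).pow (Fintype.card K - 1)
  · simpa using h1.pow (Fintype.card K - 1)

theorem card_sub_one_ne_zero : Fintype.card K - 1 ≠ 0 :=
  Nat.sub_ne_zero_of_lt Fintype.one_lt_card

theorem eval_lagrangeForm [DecidableEq K] (s t : K) :
    eval ![t, 1] (lagrangeForm s) = if t = s then 1 else 0 := by
  split_ifs with h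
  · simp [lagrangeForm, h, card_sub_one_ne_zero]
  · simp [lagrangeForm, FiniteField.pow_card_sub_one_eq_one _ (sub_ne_zero.2 h)]

theorem eval_one_zero_lagrangeForm (s : K) : eval ![1, 0] (lagrangeForm s) = -1 := by
  simp [lagrangeForm, card_sub_one_ne_zero]

theorem isHomogeneous_sum_lagrangeForm (c : K → K) :
    (∑ s, C (c s) * lagrangeForm s).IsHomogeneous (Fintype.card K - 1) :=
  IsHomogeneous.sum _ _ _ fun s _ => by
    simpa using (isHomogeneous_C (Fin 2) (c s)).mul (isHomogeneous_lagrangeForm s)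

theorem eval_sum_lagrangeForm (c : K → K) (t : K) :
    eval ![t, 1] (∑ s, C (c s) * lagrangeForm s) = c t := by
  classical
  simp [eval_lagrangeForm]

/-- By Lagrange interpolation it suffices to check the forms `lagrangeForm s`, each with value `-1`
at infinity and values of sum `1` on the affine line. -/
theorem eval_one_zero_eq_neg_sum {f : MvPolynomial (Fin 2) K}
    (hf : f.IsHomogeneous (Fintype.card K - 1)) :
    eval ![1, 0] f = -∑ t, eval ![t, 1] f := by
  have h : f = ∑ s, C (eval ![s, 1] f) * lagrangeForm s :=
    eq_of_eval_eq_of_lt_card hf (isHomogeneous_sum_lagrangeForm _) Finset.univ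
      (Nat.sub_lt Fintype.card_pos one_pos) fun t _ =>
        (eval_sum_lagrangeForm (fun s => eval ![s, 1] f) t).symm
  conv_lhs => rw [h]
  simp [eval_one_zero_lagrangeForm]

/-- Binary forms of degree `q - 1` over a field of order `q` are the functions on the affine
line. -/
noncomputable def formEquiv {n : ℕ} (hn : n = Fintype.card K - 1) :
    homogeneousSubmodule (Fin 2) K n ≃ₗ[K] (K → K) :=
  LinearEquiv.ofBijective
    (LinearMap.pi fun t => (aeval (![t, 1] : Fin 2 → K)).toLinearMap ∘ₗ
      (homogeneousSubmodule (Fin 2) K n).subtype) <| by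
    subst hn
    constructor
    · intro f g hfg
      refine Subtype.ext (eq_of_eval_eq_of_lt_card f.2 g.2 Finset.univ
        (Nat.sub_lt Fintype.card_pos one_pos) fun t _ => ?_)
      simpa [MvPolynomial.aeval_eq_eval] using congrFun hfg t
    · intro c
      refine ⟨⟨∑ s, C (c s) * lagrangeForm s, isHomogeneous_sum_lagrangeForm c⟩, funext fun t => ?_⟩
      simpa [MvPolynomial.aeval_eq_eval] using eval_sum_lagrangeForm c t

theorem formEquiv_apply {n : ℕ} (hn : n = Fintype.card K - 1)
    (f : homogeneousSubmodule (Fin 2) K n) (t : K) :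
    formEquiv hn f t = eval ![t, 1] (f : MvPolynomial (Fin 2) K) := by
  change aeval ![t, 1] (f : MvPolynomial (Fin 2) K) = _
  rw [MvPolynomial.aeval_eq_eval]

/-- The action of `SL₂` on the projective line. -/
def projectiveLinePerm {K : Type*} [Field K] [DecidableEq K] :
    Matrix.SpecialLinearGroup (Fin 2) K →* Equiv.Perm (Option K) :=
  (MulAction.toPermHom (GL (Fin 2) K) (OnePoint K)).comp Matrix.SpecialLinearGroup.toGL

theorem projectiveLinePerm_inv_some {K : Type*} [Field K] [DecidableEq K]
    (g : Matrix.SpecialLinearGroup (Fin 2) K) (t : K) :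
    (projectiveLinePerm g)⁻¹ (some t) =
      if g⁻¹ 1 0 * t + g⁻¹ 1 1 = 0 then none
      else some ((g⁻¹ 0 0 * t + g⁻¹ 0 1) / (g⁻¹ 1 0 * t + g⁻¹ 1 1)) := by
  rw [← map_inv]
  exact OnePoint.smul_some_eq_ite (g := Matrix.SpecialLinearGroup.toGL g⁻¹) (k := t)

/-- Rescaling `g⁻¹ (t, 1)` to a standard representative of its projective point changes no value, as
the factor has `n`-th power `1`. -/
theorem formEquiv_homPolyRep [DecidableEq K] (k : Type*) [CommRing k] [Algebra k K] {n : ℕ}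
    (hn : n = Fintype.card K - 1) (g : Matrix.SpecialLinearGroup (Fin 2) K)
    (f : homogeneousSubmodule (Fin 2) K n) :
    formEquiv hn (homPolyRep k K n g f) =
      sumZeroRep K (projectiveLinePerm g) (formEquiv hn f) := by
  ext t
  rw [formEquiv_apply, homPolyRep_apply_coe, eval_polySubst, sumZeroRep_apply,
    projectiveLinePerm_inv_some]
  set h := g⁻¹
  have hdet : h 0 0 * h 1 1 - h 0 1 * h 1 0 = 1 := by
    rw [← Matrix.det_fin_two]; exact h.2
  have hpow : ∀ x : K, x ≠ 0 → x ^ n = 1 := fun x hx => by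
    rw [hn, FiniteField.pow_card_sub_one_eq_one x hx]
  split_ifs with hz
  -- Here `g⁻¹` sends `t` to infinity; invertibility keeps the first coordinate nonzero.
  · have hx : h 0 0 * t + h 0 1 ≠ 0 := by
      intro hx
      apply one_ne_zero (α := K)
      linear_combination (-1 : K) * hdet + h 0 0 * hz - h 1 0 * hx
    have hv : (h : Matrix (Fin 2) (Fin 2) K) *ᵥ ![t, 1] = (h 0 0 * t + h 0 1) • ![1, 0] := by
      ext i
      fin_cases i
      · simp
      · simpa using hz
    rw [hv, eval_smul_of_isHomogeneous f.2, hpow _ hx, one_mul,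
      eval_one_zero_eq_neg_sum (hn ▸ f.2)]
    simp [sumZeroExtend, formEquiv_apply]
  · have hv : (h : Matrix (Fin 2) (Fin 2) K) *ᵥ ![t, 1] =
        (h 1 0 * t + h 1 1) • ![(h 0 0 * t + h 0 1) / (h 1 0 * t + h 1 1), 1] := by
      ext i
      fin_cases i
      · simp [mul_div_cancel₀ _ hz]
      · simp
    rw [hv, eval_smul_of_isHomogeneous f.2, hpow _ hz, one_mul]
    exact (formEquiv_apply hn f _).symm

end FiniteField

/-! ### The integral lift for `r = 1` and the conclusion -/

/-- Over a field of order `p`, the forms of degree `p - 1` are the reduction of the integral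
functions with sum zero on the projective line. -/
theorem exists_integral_lift_homPolyRep (p : ℕ) [Fact p.Prime] (K : Type*) [Field K] [Fintype K]
    [DecidableEq K] [Algebra (ZMod p) K] (hK : Fintype.card K = p) :
    ∃ (θ : Matrix.SpecialLinearGroup (Fin 2) K →* GL K ℤ)
      (φ : homogeneousSubmodule (Fin 2) K (p - 1) ≃ₗ[ZMod p] (K → ZMod p)),
      ∀ g v, φ (homPolyRep (ZMod p) K (p - 1) g v) =
        (θ g).1.map (Int.cast : ℤ → ZMod p) *ᵥ φ v := by
  have hn : p - 1 = Fintype.card K - 1 := by rw [hK]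
  have hbij : Function.Bijective (Algebra.ofId (ZMod p) K) :=
    (Fintype.bijective_iff_injective_and_card _).2
      ⟨(algebraMap (ZMod p) K).injective, by rw [ZMod.card, hK]⟩
  let e : K ≃ₐ[ZMod p] ZMod p := (AlgEquiv.ofBijective _ hbij).symm
  refine ⟨sumZeroGL.comp projectiveLinePerm,
    ((formEquiv hn).restrictScalars (ZMod p)).trans
      (LinearEquiv.piCongrRight fun _ => e.toLinearEquiv), fun g v => ?_⟩
  ext t
  change e (formEquiv hn _ t) = _
  rw [formEquiv_homPolyRep, ← sumZeroGL_map_mulVec]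
  -- The matrix comes from integers, so `e` carries its image over `K` to its image over `ZMod p`.
  refine (RingHom.map_mulVec e.toRingEquiv.toRingHom _ _ t).trans ?_
  rw [Matrix.map_map]
  refine congrFun (congrArg₂ _ ?_ rfl) t
  ext i j
  simp

theorem mainTheorem5 (p : ℕ) [Fact p.Prime] (hp : p ≠ 2) (r : ℕ)
    (K : Type*) [Field K] [Algebra (ZMod p) K] (hK : Nat.card K = p ^ r) :
    (LiftsToZModPow (homPolyRep (ZMod p) K (p - 1)) 2 two_ne_zero ↔ r = 1) ∧
      (r = 1 → LiftsToPadic (homPolyRep (ZMod p) K (p - 1))) := by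
  classical
  have : Finite K := Nat.finite_of_card_ne_zero (hK ▸ pow_ne_zero r (Fact.out : p.Prime).ne_zero)
  have : Fintype K := Fintype.ofFinite K
  have hlift (hr : r = 1) := exists_integral_lift_homPolyRep p K
    (by rw [← Nat.card_eq_fintype_card, hK, hr, pow_one])
  refine ⟨⟨eq_one_of_liftsToZModPow hp hK, fun hr => ?_⟩, fun hr => ?_⟩
  · obtain ⟨θ, φ, h⟩ := hlift hr
    exact liftsToZModPow_of_integral_lift θ φ h 2 two_ne_zero
  · obtain ⟨θ, φ, h⟩ := hlift hr
    exact liftsToPadic_of_integral_lift θ φ h
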